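/- Call a meromorphic function $f:\mathbb C\to\widehat{\mathbb C}=\mathbb C\cup\{\infty\}$ transcendental if it is not a rational function. A point $b\in\widehat{\mathbb C}$ is an asymptotic value of $f$ if there is a curve $\gamma:[0,\infty)\to\mathbb C$ with $\gamma(t)\to\infty$ and $f(\gamma(t))\to b$ as $t\to\infty$; a finite critical value of $f$ is a number $f(c)\in\mathbb C$, where $c\in\mathbb C$ is not a pole of $f$ and $f'(c)=0$. Class $\mathcal B$ consists of all transcendental meromorphic functions $f:\mathbb C\to\widehat{\mathbb C}$ for which the set of finite critical values and finite asymptotic values is bounded. The order of $f$ is $\rho(f)=\limsup_{r\to\infty}\frac{\log T(r,f)}{\log r}\in[0,\infty]$, where $T(r,f)$ is the Nevanlinna characteristic. The escaping set of $f$ is $$\mathcal I(f)=\{z\in\mathbb C:\ f^n(z)\in\mathbb C \text{ is defined for all } n\ge 0 \text{ and } f^n(z)\to\infty \text{ as } n\to\infty\},$$ and $\mathrm{HD}$ denotes Hausdorff dimension with respect to the Euclidean metric. **Theorem.** 1. There exists $f\in\mathcal B$ with $0<\rho(f)<\infty$ such that $\infty$ is not an asymptotic value of $f$, the multiplicities of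 the poles of $f$ are uniformly bounded, and $\mathrm{HD}(\mathcal I(f))=0$. 2. There exists $f\in\mathcal B$ with $\rho(f)=\infty$ such that $\infty$ is not an asymptotic value of $f$, the multiplicities of the poles of $f$ are uniformly bounded, and $\mathrm{HD}(\mathcal I(f))=0$. -/

import Mathlib

open Filter Topology

namespace MeromorphicDynamics

/-- A meromorphic function on `ℂ` is represented by `f : ℂ → ℂ` in Mathlib's normal form: at each
point `f` is either analytic, or has a pole and takes there the placeholder value `0`. Normal form
leaves no freedom in the values of `f`; the genuine value `∞` at the poles is restored in
`toSphere`. -/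
def IsMeromorphicFunction (f : ℂ → ℂ) : Prop :=
  MeromorphicNFOn f Set.univ

/-- `f` has a pole at `z`. -/
def IsPole (f : ℂ → ℂ) (z : ℂ) : Prop :=
  meromorphicOrderAt f z < 0

open Classical in
/-- The meromorphic function `f` as a map from `ℂ` to the Riemann sphere `ℂ ∪ {∞}`. -/
noncomputable def toSphere (f : ℂ → ℂ) (z : ℂ) : OnePoint ℂ :=
  if IsPole f z then OnePoint.infty else (f z : OnePoint ℂ)

/-- `f` is a rational function. -/
def IsRational (f : ℂ → ℂ) : Prop :=
  ∃ p q : Polynomial ℂ, q ≠ 0 ∧ ∀ z : ℂ, q.eval z ≠ 0 → f z = p.eval z / q.eval z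

/-- A transcendental meromorphic function on the plane. -/
def IsTranscendentalMeromorphic (f : ℂ → ℂ) : Prop :=
  IsMeromorphicFunction f ∧ ¬ IsRational f

/-- `b ∈ ℂ ∪ {∞}` is an asymptotic value of `f`: there is a curve `γ : [0, ∞) → ℂ` tending to `∞`
along which `f` tends to `b` in the Riemann sphere. -/
def IsAsymptoticValue (f : ℂ → ℂ) (b : OnePoint ℂ) : Prop :=
  ∃ γ : ℝ → ℂ, ContinuousOn γ (Set.Ici 0) ∧ Tendsto γ atTop (cocompact ℂ) ∧
    Tendsto (fun t => toSphere f (γ t)) atTop (𝓝 b)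

/-- `w ∈ ℂ` is a (finite) critical value: the value of `f` at a point that is not a pole and at
which the derivative vanishes. -/
def IsCriticalValue (f : ℂ → ℂ) (w : ℂ) : Prop :=
  ∃ c : ℂ, ¬ IsPole f c ∧ deriv f c = 0 ∧ f c = w

/-- The set `S(f)` of finite singular values. -/
def singularSet (f : ℂ → ℂ) : Set ℂ :=
  {w : ℂ | IsCriticalValue f w ∨ IsAsymptoticValue f (w : OnePoint ℂ)}

/-- The Eremenko-Lyubich class `𝓑` of transcendental meromorphic functions with bounded `S(f)`. -/
def ClassB (f : ℂ → ℂ) : Prop :=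
  IsTranscendentalMeromorphic f ∧ Bornology.IsBounded (singularSet f)

/-- The multiplicities of all poles of `f` are at most some common `M`. -/
def HasPolesOfBoundedMultiplicity (f : ℂ → ℂ) : Prop :=
  ∃ M : ℕ, ∀ z : ℂ, IsPole f z → ((-(M : ℤ) : ℤ) : WithTop ℤ) ≤ meromorphicOrderAt f z

/-- The order of growth `limsup_{r → ∞} log T(r, f) / log r`, with `T(r, f)` the Nevanlinna
characteristic. -/
noncomputable def growthOrder (f : ℂ → ℂ) : EReal :=
  limsup (fun r : ℝ =>
    ((Real.log (ValueDistribution.characteristic f ⊤ r) / Real.log r : ℝ) : EReal)) atTop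

/-- The escaping set `I(f)`: the points `z` all of whose iterates `fⁿ(z)` are defined as points of
`ℂ` (the orbit meets no pole) and tend to `∞`. -/
def escapingSet (f : ℂ → ℂ) : Set ℂ :=
  {z : ℂ | (∀ n : ℕ, ¬ IsPole f (f^[n] z)) ∧
    Tendsto (fun n : ℕ => f^[n] z) atTop (cocompact ℂ)}

end MeromorphicDynamics

/-!
Both functions have the form `f(z) = ∑ c n / (z - a n)` with simple poles `0 < a n → ∞` and very
small residues `c n > 0`. Fix pairwise disjoint discs `B(a n, ρ n)` and let
`c n = (ρ n) ^ 2 / 2 ^ (n + 1)`. Then `‖f‖ ≤ 1` outside the discs, while on the `n`-th disc `f` is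
the sum of `c n / (z - a n)` and a function bounded by `1` and Lipschitz with constant `1`
(`norm_partialFraction_le`, `norm_partialFraction_sub_le`). Three facts follow.

* Where `‖f‖ > 3`, the singular part dominates: on the `n`-th disc `f` expands distances by at least
  `1 / c n` (`norm_sub_le_mul`). So there are no critical values of modulus larger than `3`. The
  circles `‖z‖ = a n + ρ n` avoid all discs, and every curve to `∞` crosses infinitely many of them;
  hence all asymptotic values lie in the closed unit disc, and `f` is in the class `𝓑`.

* The orbit of an escaping point finally stays in the discs of index at least `K`, at points where
  `‖f‖ > 3`. For given `t > 0` choose `K` with `∑_{n ≥ K} (c n) ^ t ≤ 1 / 2`. Pulling back the cover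
  by these discs `m` times along the orbits produces covers whose `t`-dimensional size is at most
  `2 ^ (-m - 1)`, so that the set of staying points is a null set of the `t`-dimensional Hausdorff
  measure (`hausdorffMeasure_eq_zero_of_expanding`). Its iterated preimages do not have larger
  dimension (`dimH_iterate_preimage_le`), since `f` is locally bi-Lipschitz off a discrete set.

* The residues hardly influence the growth of `f`, which is governed by the number of poles. Poles
  at the positive integers give `r / 8 ≤ T(r, f) ≤ r ^ 3`, and poles at `log (n + 2)` give
  `T(r, f) ≥ exp (r / 4)`. The proximity function is controlled by Jensen's formula for `z - a n`
  (`proximity_le`).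
-/

open Filter Topology

namespace MeromorphicDynamics

/-! ### Partial fractions with small residues -/

/-- Positive poles `a n → ∞` together with radii `ρ n ≤ 1` such that the discs
`B(a n, ρ n)` are pairwise disjoint. -/
structure PoleConfiguration where
  /-- the poles -/
  a : ℕ → ℝ
  /-- the radii of the discs around the poles -/
  ρ : ℕ → ℝ
  a_pos : ∀ n, 0 < a n
  tendsto_a : Tendsto a atTop atTop
  ρ_pos : ∀ n, 0 < ρ n
  ρ_le_one : ∀ n, ρ n ≤ 1
  separated : ∀ m n, m ≠ n → ρ m + ρ n ≤ |a m - a n|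

namespace PoleConfiguration

variable (P : PoleConfiguration)

/-- The residue at the pole `a n`; it is so small that `∑ c n / (ρ n) ^ 2 = 1`. -/
noncomputable def c (n : ℕ) : ℝ := P.ρ n ^ 2 * (1 / 2 / 2 ^ n)

lemma c_pos (n : ℕ) : 0 < P.c n := by
  have := P.ρ_pos n
  unfold c; positivity

lemma half_pow_pos (n : ℕ) : (0 : ℝ) < 1 / 2 / 2 ^ n := by positivity

lemma summable_half_pow : Summable fun n : ℕ => (1 : ℝ) / 2 / 2 ^ n := summable_geometric_two' 1

lemma c_le_half_pow (n : ℕ) : P.c n ≤ 1 / 2 / 2 ^ n :=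
  mul_le_of_le_one_left (half_pow_pos n).le (pow_le_one₀ (P.ρ_pos n).le (P.ρ_le_one n))

lemma c_le_half (n : ℕ) : P.c n ≤ 1 / 2 := by
  refine (P.c_le_half_pow n).trans (div_le_self (by norm_num) (one_le_pow₀ (by norm_num)))

lemma summable_c : Summable P.c :=
  Summable.of_nonneg_of_le (fun n => (P.c_pos n).le) P.c_le_half_pow summable_half_pow

lemma a_injective : Function.Injective P.a := by
  intro m n h
  by_contra hmn
  have := P.separated m n hmn
  simp only [h, sub_self, abs_zero] at this
  linarith [P.ρ_pos m, P.ρ_pos n]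

/-- The poles are locally finite. -/
lemma exists_gap (z : ℂ) : ∃ ε > 0, ∀ n, (P.a n : ℂ) ≠ z → ε ≤ ‖z - P.a n‖ := by
  have h1 : ∀ᶠ n in cofinite, 1 ≤ ‖z - P.a n‖ := by
    rw [Nat.cofinite_eq_atTop]
    filter_upwards [P.tendsto_a.eventually_ge_atTop (1 + ‖z‖)] with n hn
    have h2 : ‖(P.a n : ℂ)‖ = P.a n := by
      rw [Complex.norm_real, Real.norm_of_nonneg (P.a_pos n).le]
    have h3 := norm_sub_norm_le (P.a n : ℂ) z
    rw [norm_sub_rev] at h3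
    linarith
  have hfin : {n | ¬ 1 ≤ ‖z - P.a n‖}.Finite := h1
  have h4 : ∀ᶠ ε in 𝓝[>] (0 : ℝ), ∀ n ∈ {n | ¬ 1 ≤ ‖z - P.a n‖},
      (P.a n : ℂ) ≠ z → ε ≤ ‖z - P.a n‖ := by
    rw [hfin.eventually_all]
    intro n _
    by_cases hz : (P.a n : ℂ) = z
    · simp [hz]
    · filter_upwards [Ioc_mem_nhdsGT (norm_pos_iff.2 (sub_ne_zero.2 (Ne.symm hz)))] with ε hε _
      exact hε.2
  obtain ⟨ε, hε, h5⟩ := (h4.and (Ioc_mem_nhdsGT (one_pos : (0 : ℝ) < 1))).exists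
  refine ⟨ε, h5.1, fun n hn => ?_⟩
  by_cases h : 1 ≤ ‖z - P.a n‖
  · exact h5.2.trans h
  · exact hε n h hn

/-- The partial fraction series over the poles with index in `S`. The term of a pole `z = a n` is
`c n / 0 = 0`. -/
noncomputable def partialFraction (S : Set ℕ) (z : ℂ) : ℂ :=
  ∑' n, S.indicator (fun n => (P.c n : ℂ) / (z - P.a n)) n

lemma norm_indicator_le {S : Set ℕ} {z : ℂ} {ε : ℝ} (hε : 0 < ε)
    (h : ∀ n ∈ S, (P.a n : ℂ) ≠ z → ε ≤ ‖z - P.a n‖) (n : ℕ) :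
    ‖S.indicator (fun n => (P.c n : ℂ) / (z - P.a n)) n‖ ≤ P.c n / ε := by
  have hc := P.c_pos n
  by_cases hn : n ∈ S
  · rw [Set.indicator_of_mem hn]
    by_cases hz : (P.a n : ℂ) = z
    · rw [hz, sub_self, div_zero, norm_zero]; positivity
    · rw [norm_div, Complex.norm_real, Real.norm_of_nonneg hc.le]
      gcongr
      exact h n hn hz
  · rw [Set.indicator_of_notMem hn, norm_zero]; positivity

lemma summable_partialFraction (S : Set ℕ) (z : ℂ) :
    Summable (S.indicator (fun n => (P.c n : ℂ) / (z - P.a n))) := by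
  obtain ⟨ε, hε, h⟩ := P.exists_gap z
  exact Summable.of_norm_bounded (P.summable_c.div_const ε)
    (P.norm_indicator_le hε fun n _ => h n)

lemma partialFraction_univ (n : ℕ) (z : ℂ) :
    P.partialFraction Set.univ z = P.c n / (z - P.a n) + P.partialFraction {n}ᶜ z := by
  unfold partialFraction
  rw [(P.summable_partialFraction _ z).tsum_eq_add_tsum_ite n]
  simp only [Set.indicator_univ]
  congr 2
  ext m
  by_cases hm : m = n <;> simp [hm]

lemma analyticAt_partialFraction {S : Set ℕ} {z₀ : ℂ} (h : ∀ n ∈ S, (P.a n : ℂ) ≠ z₀) :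
    AnalyticAt ℂ (P.partialFraction S) z₀ := by
  obtain ⟨ε, hε, hgap⟩ := P.exists_gap z₀
  have hd : ∀ n ∈ S, ∀ z ∈ Metric.ball z₀ (ε / 2), ε / 2 ≤ ‖z - P.a n‖ := by
    intro n hn z hz
    have h1 := hgap n (h n hn)
    have h2 := norm_sub_le_norm_sub_add_norm_sub z₀ z (P.a n : ℂ)
    rw [Metric.mem_ball, dist_comm, dist_eq_norm] at hz
    linarith
  refine DifferentiableOn.analyticAt (s := Metric.ball z₀ (ε / 2)) ?_
    (Metric.ball_mem_nhds _ (by positivity))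
  refine Complex.differentiableOn_tsum_of_summable_norm (P.summable_c.div_const (ε / 2))
    (fun n => ?_) Metric.isOpen_ball
    (fun n z hz => P.norm_indicator_le (half_pos hε) (fun m hm _ => hd m hm z hz) n)
  by_cases hn : n ∈ S
  · simp only [Set.indicator_of_mem hn]
    refine DifferentiableOn.div (by fun_prop) (by fun_prop) fun z hz h0 => ?_
    have := hd n hn z hz
    rw [h0, norm_zero] at this
    linarith
  · simp only [Set.indicator_of_notMem hn]
    fun_prop

lemma norm_partialFraction_le {S : Set ℕ} {z : ℂ} (h : ∀ n ∈ S, P.ρ n ≤ ‖z - P.a n‖) :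
    ‖P.partialFraction S z‖ ≤ 1 := by
  refine tsum_of_norm_bounded (hasSum_geometric_two' (1 : ℝ)) fun n => ?_
  have hρ := P.ρ_pos n
  by_cases hn : n ∈ S
  · rw [Set.indicator_of_mem hn, norm_div, Complex.norm_real, Real.norm_of_nonneg (P.c_pos n).le]
    have h1 := h n hn
    rw [div_le_iff₀ (hρ.trans_le h1), c, mul_comm]
    have := half_pow_pos n
    gcongr
    nlinarith [P.ρ_le_one n]
  · rw [Set.indicator_of_notMem hn, norm_zero]; positivity

lemma norm_partialFraction_sub_le {S : Set ℕ} {z w : ℂ} (hz : ∀ n ∈ S, P.ρ n ≤ ‖z - P.a n‖)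
    (hw : ∀ n ∈ S, P.ρ n ≤ ‖w - P.a n‖) :
    ‖P.partialFraction S z - P.partialFraction S w‖ ≤ ‖z - w‖ := by
  unfold partialFraction
  rw [← (P.summable_partialFraction S z).tsum_sub (P.summable_partialFraction S w)]
  have hs := (hasSum_geometric_two' (1 : ℝ)).mul_right ‖z - w‖
  rw [one_mul] at hs
  refine tsum_of_norm_bounded hs fun n => ?_
  have hρ := P.ρ_pos n
  by_cases hn : n ∈ S
  · rw [Set.indicator_of_mem hn, Set.indicator_of_mem hn]
    have h1 := hz n hn
    have h2 := hw n hn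
    have hz0 : z - P.a n ≠ 0 := norm_pos_iff.1 (hρ.trans_le h1)
    have hw0 : w - P.a n ≠ 0 := norm_pos_iff.1 (hρ.trans_le h2)
    have e : (P.c n : ℂ) / (z - P.a n) - P.c n / (w - P.a n)
        = P.c n * (w - z) / ((z - P.a n) * (w - P.a n)) := by
      field_simp; ring
    rw [e, norm_div, norm_mul, norm_mul, Complex.norm_real, Real.norm_of_nonneg (P.c_pos n).le,
      norm_sub_rev w z, div_le_iff₀ (mul_pos (hρ.trans_le h1) (hρ.trans_le h2)), c]
    have h3 : P.ρ n ^ 2 ≤ ‖z - P.a n‖ * ‖w - P.a n‖ := by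
      rw [sq]; gcongr
    calc P.ρ n ^ 2 * (1 / 2 / 2 ^ n) * ‖z - w‖
        = 1 / 2 / 2 ^ n * ‖z - w‖ * P.ρ n ^ 2 := by ring
      _ ≤ _ := by gcongr
  · rw [Set.indicator_of_notMem hn, Set.indicator_of_notMem hn, sub_zero, norm_zero]; positivity

open Classical in
/-- The meromorphic function `∑ c n / (z - a n)`, in normal form: at the poles its value is `0`. -/
noncomputable def f (z : ℂ) : ℂ :=
  if ∃ n, z = P.a n then 0 else P.partialFraction Set.univ z

lemma f_apply_pole (n : ℕ) : P.f (P.a n) = 0 := if_pos ⟨n, rfl⟩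

lemma f_apply {z : ℂ} (hz : ∀ n, z ≠ P.a n) : P.f z = P.partialFraction Set.univ z :=
  if_neg (by simpa using hz)

lemma f_eq_add {z : ℂ} (hz : ∀ n, z ≠ P.a n) (n : ℕ) :
    P.f z = P.c n / (z - P.a n) + P.partialFraction {n}ᶜ z := by
  rw [P.f_apply hz, P.partialFraction_univ n]

lemma eventually_not_pole (z₀ : ℂ) : ∀ᶠ z : ℂ in 𝓝[≠] z₀, ∀ n, z ≠ P.a n := by
  obtain ⟨ε, hε, h⟩ := P.exists_gap z₀
  filter_upwards [self_mem_nhdsWithin, nhdsWithin_le_nhds (Metric.ball_mem_nhds z₀ hε)]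
    with z hz hz' n hn
  subst hn
  have := h n hz
  rw [Metric.mem_ball, dist_comm, dist_eq_norm] at hz'
  linarith

lemma analyticAt_f {z : ℂ} (hz : ∀ n, z ≠ P.a n) : AnalyticAt ℂ P.f z := by
  refine (P.analyticAt_partialFraction (S := Set.univ) fun n _ => (hz n).symm).congr ?_
  have h := eventually_nhdsWithin_iff.1 (P.eventually_not_pole z)
  filter_upwards [h] with w hw
  refine (P.f_apply ?_).symm
  by_cases hwz : w = z
  · rwa [hwz]
  · exact hw hwz

/-- At a pole, `f` is `(z - a n)⁻¹` times an analytic function with value `c n`. -/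
lemma exists_eq_inv_mul (n : ℕ) : ∃ g : ℂ → ℂ, AnalyticAt ℂ g (P.a n) ∧ g (P.a n) ≠ 0 ∧
    P.f =ᶠ[𝓝 (P.a n : ℂ)] ((fun z => z - (P.a n : ℂ)) ^ (-1 : ℤ)) • g := by
  refine ⟨fun z => P.c n + (z - P.a n) * P.partialFraction {n}ᶜ z, ?_, ?_, ?_⟩
  · have := P.analyticAt_partialFraction (S := {n}ᶜ) (z₀ := (P.a n : ℂ)) (fun m hm h =>
      hm (P.a_injective (by exact_mod_cast h)))
    fun_prop
  · have := P.c_pos n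
    simp only [sub_self, zero_mul, add_zero]
    exact_mod_cast this.ne'
  · filter_upwards [eventually_nhdsWithin_iff.1 (P.eventually_not_pole (P.a n))] with z hz
    by_cases h : z = P.a n
    · subst h
      simp [f_apply_pole]
    · rw [P.f_eq_add (hz h) n]
      have : z - P.a n ≠ 0 := sub_ne_zero.2 h
      simp only [Pi.smul_apply', zpow_neg, zpow_one, smul_eq_mul, Pi.inv_apply]
      field_simp

lemma isMeromorphicFunction_f : IsMeromorphicFunction P.f := by
  intro z _
  by_cases hz : ∃ n, z = P.a n
  · obtain ⟨n, rfl⟩ := hz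
    exact Or.inr ⟨-1, P.exists_eq_inv_mul n⟩
  · exact (P.analyticAt_f (by simpa using hz)).meromorphicNFAt

lemma meromorphicAt_f (z : ℂ) : MeromorphicAt P.f z :=
  (P.isMeromorphicFunction_f (Set.mem_univ z)).meromorphicAt

lemma order_pole (n : ℕ) : meromorphicOrderAt P.f (P.a n) = ((-1 : ℤ) : WithTop ℤ) := by
  obtain ⟨g, h1, h2, h3⟩ := P.exists_eq_inv_mul n
  exact (meromorphicOrderAt_eq_int_iff (P.meromorphicAt_f _)).2
    ⟨g, h1, h2, h3.filter_mono nhdsWithin_le_nhds⟩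

lemma isPole_iff {z : ℂ} : IsPole P.f z ↔ ∃ n, z = P.a n := by
  constructor
  · intro h
    by_contra hz
    exact absurd (P.analyticAt_f (by simpa using hz)).meromorphicOrderAt_nonneg (not_le.2 h)
  · rintro ⟨n, rfl⟩
    rw [IsPole, P.order_pole n]
    decide

lemma not_isPole_iff {z : ℂ} : ¬ IsPole P.f z ↔ ∀ n, z ≠ P.a n := by
  rw [isPole_iff, not_exists]

lemma hasPolesOfBoundedMultiplicity_f : HasPolesOfBoundedMultiplicity P.f := by
  refine ⟨1, fun z hz => ?_⟩
  obtain ⟨n, rfl⟩ := P.isPole_iff.1 hz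
  rw [P.order_pole n]
  rfl

/-- The poles of `f` are infinite in number, whereas those of a rational function lie among the
zeros of its denominator. -/
lemma not_isRational_f : ¬ IsRational P.f := by
  rintro ⟨p, q, hq, h⟩
  have hfin : {z : ℂ | q.eval z = 0}.Finite := by
    refine (q.roots.toFinset.finite_toSet).subset fun z hz => ?_
    simpa [hq] using hz
  have hinj : Function.Injective fun n => (P.a n : ℂ) :=
    Complex.ofReal_injective.comp P.a_injective
  obtain ⟨_, ⟨n, rfl⟩, hn⟩ := (Set.infinite_range_of_injective hinj).exists_notMem_finite hfin
  have hq0 : q.eval (P.a n : ℂ) ≠ 0 := hn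
  have han : AnalyticAt ℂ (fun z => p.eval z / q.eval z) (P.a n : ℂ) :=
    (AnalyticOnNhd.eval_polynomial p _ (Set.mem_univ _)).div
      (AnalyticOnNhd.eval_polynomial q _ (Set.mem_univ _)) hq0
  have hev : (fun z => p.eval z / q.eval z) =ᶠ[𝓝 (P.a n : ℂ)] P.f := by
    have : ∀ᶠ z in 𝓝 (P.a n : ℂ), q.eval z ≠ 0 := q.continuous.continuousAt.eventually_ne hq0
    filter_upwards [this] with z hz
    exact (h z hz).symm
  exact absurd (han.congr hev).meromorphicOrderAt_nonneg (not_le.2 (P.isPole_iff.2 ⟨n, rfl⟩))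

lemma isTranscendentalMeromorphic_f : IsTranscendentalMeromorphic P.f :=
  ⟨P.isMeromorphicFunction_f, P.not_isRational_f⟩

/-! ### Smallness outside the discs and expansion inside -/

lemma le_norm_sub_of_mem_disc {n : ℕ} {z : ℂ} (hz : ‖z - P.a n‖ < P.ρ n) :
    ∀ m ∈ ({n}ᶜ : Set ℕ), P.ρ m ≤ ‖z - P.a m‖ := by
  intro m hm
  have h1 := P.separated m n hm
  have h2 : |P.a m - P.a n| = ‖(P.a m : ℂ) - P.a n‖ := by
    rw [← Complex.ofReal_sub, Complex.norm_real, Real.norm_eq_abs]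
  have h3 := norm_sub_le_norm_sub_add_norm_sub (P.a m : ℂ) z (P.a n)
  rw [norm_sub_rev _ z] at h3
  linarith

lemma norm_f_le_one {z : ℂ} (hz : ∀ n, P.ρ n ≤ ‖z - P.a n‖) : ‖P.f z‖ ≤ 1 := by
  rw [P.f_apply]
  · exact P.norm_partialFraction_le fun n _ => hz n
  · rintro n rfl
    have := hz n
    rw [sub_self, norm_zero] at this
    linarith [P.ρ_pos n]

lemma not_pole_of_norm_f {z : ℂ} (hz : 3 < ‖P.f z‖) (n : ℕ) : z ≠ P.a n := by
  rintro rfl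
  rw [f_apply_pole, norm_zero] at hz
  linarith

lemma exists_mem_disc {z : ℂ} (hz : 3 < ‖P.f z‖) : ∃ n, ‖z - P.a n‖ < P.ρ n := by
  by_contra! h
  linarith [P.norm_f_le_one h]

lemma norm_sub_pole_le {n : ℕ} {z : ℂ} (hzn : ‖z - P.a n‖ < P.ρ n) (hz : 3 < ‖P.f z‖) :
    ‖z - P.a n‖ ≤ P.c n / 2 := by
  have h0 := P.not_pole_of_norm_f hz
  rw [P.f_eq_add h0 n] at hz
  have h1 := norm_add_le (P.c n / (z - P.a n) : ℂ) (P.partialFraction {n}ᶜ z)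
  have h2 := P.norm_partialFraction_le (P.le_norm_sub_of_mem_disc hzn)
  have h3 : 2 ≤ ‖(P.c n / (z - P.a n) : ℂ)‖ := by linarith
  have h4 : 0 < ‖z - P.a n‖ := norm_pos_iff.2 (sub_ne_zero.2 (h0 n))
  rw [norm_div, Complex.norm_real, Real.norm_of_nonneg (P.c_pos n).le, le_div_iff₀ h4] at h3
  linarith

/-- Where `‖f‖ > 3`, the singular part dominates and `f` is expanding on each disc. -/
lemma norm_sub_le_mul {n : ℕ} {z w : ℂ} (hzn : ‖z - P.a n‖ < P.ρ n)
    (hwn : ‖w - P.a n‖ < P.ρ n) (hz : 3 < ‖P.f z‖) (hw : 3 < ‖P.f w‖) :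
    ‖z - w‖ ≤ P.c n * ‖P.f z - P.f w‖ := by
  have hz0 := P.not_pole_of_norm_f hz
  have hw0 := P.not_pole_of_norm_f hw
  have h1 := P.norm_sub_pole_le hzn hz
  have h2 := P.norm_sub_pole_le hwn hw
  have hz1 : z - P.a n ≠ 0 := sub_ne_zero.2 (hz0 n)
  have hw1 : w - P.a n ≠ 0 := sub_ne_zero.2 (hw0 n)
  have hc := P.c_pos n
  have hc1 := P.c_le_half n
  have h3 := P.norm_partialFraction_sub_le (P.le_norm_sub_of_mem_disc hzn)
    (P.le_norm_sub_of_mem_disc hwn)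
  have e : (P.c n : ℂ) / (z - P.a n) - P.c n / (w - P.a n)
      = P.c n * (w - z) / ((z - P.a n) * (w - P.a n)) := by
    field_simp; ring
  have h4 : 4 * ‖z - w‖ ≤ P.c n * ‖(P.c n : ℂ) / (z - P.a n) - P.c n / (w - P.a n)‖ := by
    rw [e, norm_div, norm_mul, norm_mul, Complex.norm_real, Real.norm_of_nonneg hc.le,
      norm_sub_rev w z, ← mul_div_assoc,
      le_div_iff₀ (mul_pos (norm_pos_iff.2 hz1) (norm_pos_iff.2 hw1))]
    have : ‖z - P.a n‖ * ‖w - P.a n‖ ≤ (P.c n / 2) * (P.c n / 2) := by gcongr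
    nlinarith [norm_nonneg (z - w)]
  have h5 : ‖(P.c n : ℂ) / (z - P.a n) - P.c n / (w - P.a n)‖ ≤ ‖P.f z - P.f w‖ + ‖z - w‖ := by
    have : (P.c n : ℂ) / (z - P.a n) - P.c n / (w - P.a n) = (P.f z - P.f w) -
        (P.partialFraction {n}ᶜ z - P.partialFraction {n}ᶜ w) := by
      rw [P.f_eq_add hz0 n, P.f_eq_add hw0 n]; ring
    rw [this]
    exact (norm_sub_le _ _).trans (by gcongr)
  nlinarith [norm_nonneg (z - w)]

lemma deriv_f_ne_zero {z : ℂ} (hz : 3 < ‖P.f z‖) : deriv P.f z ≠ 0 := by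
  intro hd
  have han := P.analyticAt_f (P.not_pole_of_norm_f hz)
  obtain ⟨n, hn⟩ := P.exists_mem_disc hz
  have hderiv := han.differentiableAt.hasDerivAt
  rw [hd, hasDerivAt_iff_isLittleO] at hderiv
  have h1 := hderiv.def (c := 1) one_pos
  have h2 : ∀ᶠ w in 𝓝 z, 3 < ‖P.f w‖ :=
    han.continuousAt.norm.eventually (lt_mem_nhds hz)
  have h3 : ∀ᶠ w : ℂ in 𝓝 z, ‖w - P.a n‖ < P.ρ n := by
    have : ContinuousAt (fun w : ℂ => ‖w - P.a n‖) z := by fun_prop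
    exact this.eventually (gt_mem_nhds hn)
  have h4 : ∀ᶠ _w in 𝓝[≠] z, False := by
    filter_upwards [nhdsWithin_le_nhds h1, nhdsWithin_le_nhds h2, nhdsWithin_le_nhds h3,
      self_mem_nhdsWithin] with w h1 h2 h3 hw
    have h5 := P.norm_sub_le_mul h3 hn h2 hz
    simp only [smul_zero, sub_zero, one_mul] at h1
    have h6 : 0 < ‖w - z‖ := norm_pos_iff.2 (sub_ne_zero.2 hw)
    nlinarith [P.c_le_half n, P.c_pos n]
  exact h4.exists.elim fun _ h => h

/-! ### Singular values -/

/-- The circle `‖z‖ = a n + ρ n` meets none of the discs, so that `‖f‖ ≤ 1` on it. -/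
lemma radius_le_norm_sub_of_norm_eq {n : ℕ} {z : ℂ} (hz : ‖z‖ = P.a n + P.ρ n) (m : ℕ) :
    P.ρ m ≤ ‖z - P.a m‖ := by
  have h1 := abs_norm_sub_norm_le z (P.a m)
  rw [hz, Complex.norm_real, Real.norm_of_nonneg (P.a_pos m).le] at h1
  refine le_trans ?_ h1
  by_cases h : m = n
  · subst h
    rw [add_sub_cancel_left]
    exact le_abs_self _
  · have h2 := P.separated m n h
    have h3 := abs_sub_abs_le_abs_sub (P.a m - P.a n) (P.ρ n)
    rw [abs_of_pos (P.ρ_pos n)] at h3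
    have h4 : |P.a n + P.ρ n - P.a m| = |P.a m - P.a n - P.ρ n| := by
      rw [← abs_neg]; congr 1; ring
    linarith

/-- A curve tending to `∞` crosses infinitely many circles on which `‖f‖ ≤ 1`. -/
lemma isAsymptoticValue_f {b : OnePoint ℂ} (hb : IsAsymptoticValue P.f b) :
    ∃ w : ℂ, ‖w‖ ≤ 1 ∧ b = w := by
  obtain ⟨γ, hc, hγ, hlim⟩ := hb
  have hnorm : Tendsto (fun t => ‖γ t‖) atTop atTop := tendsto_norm_cocompact_atTop.comp hγ
  have hfreq : ∃ᶠ t in atTop, toSphere P.f (γ t) ∈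
      ((↑) : ℂ → OnePoint ℂ) '' Metric.closedBall 0 1 := by
    rw [frequently_atTop]
    intro T
    set T' := max T 0
    obtain ⟨n, hn⟩ := (P.tendsto_a.eventually_ge_atTop ‖γ T'‖).exists
    obtain ⟨s, hs, hs'⟩ :=
      ((hnorm.eventually_ge_atTop (P.a n + P.ρ n)).and (eventually_ge_atTop T')).exists
    have hcont : ContinuousOn (fun t => ‖γ t‖) (Set.Icc T' s) :=
      (hc.mono fun t ht => (le_max_right T 0).trans ht.1).norm
    obtain ⟨t, ht, hte⟩ := intermediate_value_Icc hs' hcont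
      (show P.a n + P.ρ n ∈ Set.Icc _ _ from ⟨by linarith [P.ρ_pos n], hs⟩)
    refine ⟨t, (le_max_left T 0).trans ht.1, P.f (γ t), ?_, ?_⟩
    · rw [mem_closedBall_zero_iff]
      exact P.norm_f_le_one (P.radius_le_norm_sub_of_norm_eq hte)
    · have : ¬ IsPole P.f (γ t) := by
        rw [not_isPole_iff]
        intro m hm
        have h := P.radius_le_norm_sub_of_norm_eq hte m
        rw [hm, sub_self, norm_zero] at h
        linarith [P.ρ_pos m]
      rw [toSphere, if_neg this]
  have hcl : IsClosed (((↑) : ℂ → OnePoint ℂ) '' Metric.closedBall 0 1) :=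
    ((isCompact_closedBall 0 1).image OnePoint.continuous_coe).isClosed
  obtain ⟨w, hw, rfl⟩ := hcl.mem_of_frequently_of_tendsto hfreq hlim
  exact ⟨w, by simpa using hw, rfl⟩

lemma not_isAsymptoticValue_infty : ¬ IsAsymptoticValue P.f OnePoint.infty := by
  intro h
  obtain ⟨w, -, hw⟩ := P.isAsymptoticValue_f h
  exact OnePoint.infty_ne_coe w hw

lemma classB_f : ClassB P.f := by
  refine ⟨P.isTranscendentalMeromorphic_f, (Metric.isBounded_closedBall (x := (0 : ℂ))
    (r := 3)).subset ?_⟩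
  rintro w (⟨z, -, hd, rfl⟩ | hw)
  · rw [mem_closedBall_zero_iff]
    by_contra! h
    exact P.deriv_f_ne_zero h hd
  · obtain ⟨v, hv, h⟩ := P.isAsymptoticValue_f hw
    rw [OnePoint.coe_injective h, mem_closedBall_zero_iff]
    linarith

end PoleConfiguration

/-! ### Hausdorff dimension -/

open MeasureTheory MeasureTheory.Measure ENNReal NNReal in
/-- If `X` is mapped into itself by `f` and is covered by pieces `Y n` of diameter at most `c n` on
which `f` expands by the factor `1 / c n`, then pulling back the cover `m` times gives a cover whose
`t`-th powers of diameters add up to at most `(∑ (c n) ^ t) ^ (m + 1)`. -/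
lemma hausdorffMeasure_eq_zero_of_expanding {E : Type*} [MetricSpace E] [MeasurableSpace E]
    [BorelSpace E] {X : Set E} {f : E → E} {Y : ℕ → Set E} {c : ℕ → ℝ≥0∞} {t : ℝ} (ht : 0 ≤ t)
    (hX : X ⊆ ⋃ n, Y n) (hf : ∀ x ∈ X, f x ∈ X)
    (hexp : ∀ n, ∀ x ∈ Y n, ∀ y ∈ Y n, edist x y ≤ c n * edist (f x) (f y))
    (hdiam : ∀ n, Metric.ediam (Y n) ≤ c n) (hc : ∀ n, c n ≤ 2⁻¹)
    (hsum : ∑' n, c n ^ t ≤ 2⁻¹) : μH[t] X = 0 := by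
  have key : ∀ m : ℕ, ∃ (ι : Type) (_ : Countable ι) (A : ι → Set E), X ⊆ ⋃ i, A i ∧
      (∀ i, Metric.ediam (A i) ≤ 2⁻¹ ^ (m + 1)) ∧
      ∑' i, Metric.ediam (A i) ^ t ≤ 2⁻¹ ^ (m + 1) := by
    intro m
    induction m with
    | zero =>
      refine ⟨ℕ, inferInstance, Y, hX, fun n => ?_, ?_⟩
      · simpa using (hdiam n).trans (hc n)
      · simp only [zero_add, pow_one]
        exact (ENNReal.tsum_le_tsum fun n => ENNReal.rpow_le_rpow (hdiam n) ht).trans hsum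
    | succ m ih =>
      obtain ⟨ι, _, A, hcov, hA, hAsum⟩ := ih
      have hB : ∀ p : ℕ × ι, Metric.ediam (Y p.1 ∩ f ⁻¹' A p.2) ≤ c p.1 * Metric.ediam (A p.2) := by
        intro p
        refine Metric.ediam_le fun x hx y hy => (hexp p.1 x hx.1 y hy.1).trans ?_
        gcongr
        exact Metric.edist_le_ediam_of_mem hx.2 hy.2
      refine ⟨ℕ × ι, inferInstance, fun p => Y p.1 ∩ f ⁻¹' A p.2, ?_, ?_, ?_⟩
      · intro x hx
        obtain ⟨n, hn⟩ := Set.mem_iUnion.1 (hX hx)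
        obtain ⟨i, hi⟩ := Set.mem_iUnion.1 (hcov (hf x hx))
        exact Set.mem_iUnion.2 ⟨(n, i), hn, hi⟩
      · intro p
        rw [pow_succ']
        exact (hB p).trans (mul_le_mul' (hc _) (hA _))
      · calc ∑' p : ℕ × ι, Metric.ediam (Y p.1 ∩ f ⁻¹' A p.2) ^ t
            ≤ ∑' p : ℕ × ι, c p.1 ^ t * Metric.ediam (A p.2) ^ t := by
              refine ENNReal.tsum_le_tsum fun p => ?_
              rw [← ENNReal.mul_rpow_of_nonneg _ _ ht]
              exact ENNReal.rpow_le_rpow (hB p) ht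
          _ = (∑' n, c n ^ t) * ∑' i, Metric.ediam (A i) ^ t := by
              rw [ENNReal.tsum_prod (f := fun n i => c n ^ t * Metric.ediam (A i) ^ t)]
              simp_rw [ENNReal.tsum_mul_left, ENNReal.tsum_mul_right]
          _ ≤ 2⁻¹ ^ (m + 1 + 1) := by
              rw [pow_succ']
              exact mul_le_mul' hsum hAsum
  choose ι _ A hcov hA hAsum using key
  have hlim : Tendsto (fun m : ℕ => (2⁻¹ : ℝ≥0∞) ^ (m + 1)) atTop (𝓝 0) :=
    (ENNReal.tendsto_pow_atTop_nhds_zero_of_lt_one (by simp)).comp (tendsto_add_atTop_nat 1)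
  have h := hausdorffMeasure_le_liminf_tsum t X (l := atTop) _ hlim A (.of_forall hA)
    (.of_forall hcov)
  refine le_antisymm (h.trans ?_) zero_le
  rw [← hlim.liminf_eq]
  exact liminf_le_liminf (.of_forall hAsum)

/-- Near a point where `f' ≠ 0` the inverse function is Lipschitz. -/
lemma dimH_inter_preimage_le {f : ℂ → ℂ} {R A : Set ℂ}
    (hR : ∀ z ∈ R, AnalyticAt ℂ f z ∧ deriv f z ≠ 0) : dimH (R ∩ f ⁻¹' A) ≤ dimH A := by
  by_contra! h
  obtain ⟨x, hx, hlt⟩ := exists_mem_nhdsWithin_lt_dimH_of_lt_dimH h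
  obtain ⟨han, hd⟩ := hR x hx.1
  have hs : HasStrictDerivAt f (deriv f x) x := han.hasStrictDerivAt
  obtain ⟨K, s, hs', hK⟩ :=
    (hs.to_localInverse hd).hasStrictFDerivAt.exists_lipschitzOnWith
  have hleft := (hs.hasStrictFDerivAt_equiv hd).eventually_left_inverse
  have hs'' : ∀ᶠ z in 𝓝 x, f z ∈ s := han.continuousAt hs'
  refine absurd (hlt _ (inter_mem_nhdsWithin _ (hleft.and hs''))) (not_lt.2 ?_)
  calc dimH _ ≤ dimH (hs.localInverse f _ x hd '' (A ∩ s)) := by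
        refine dimH_mono ?_
        rintro z ⟨⟨-, hzA⟩, hz, hzs⟩
        exact ⟨f z, ⟨hzA, hzs⟩, hz⟩
    _ ≤ dimH (A ∩ s) := (hK.mono Set.inter_subset_right).dimH_image_le
    _ ≤ dimH A := dimH_mono Set.inter_subset_left

namespace PoleConfiguration

variable (P : PoleConfiguration)

lemma eventually_deriv_ne_zero (z₀ : ℂ) : ∀ᶠ z in 𝓝[≠] z₀, deriv P.f z ≠ 0 := by
  have hmer : MeromorphicOn (deriv P.f) Set.univ := fun z _ => (P.meromorphicAt_f z).deriv
  have h0 : meromorphicOrderAt (deriv P.f) (P.a 0) ≠ ⊤ := by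
    rw [meromorphicOrderAt_ne_top_iff_eventually_ne_zero (hmer _ (Set.mem_univ _))]
    have h1 := tendsto_cobounded_of_meromorphicOrderAt_neg
      (show meromorphicOrderAt P.f (P.a 0) < 0 from P.isPole_iff.2 ⟨0, rfl⟩)
    rw [← tendsto_norm_atTop_iff_cobounded] at h1
    filter_upwards [h1.eventually_gt_atTop 3] with z hz using P.deriv_f_ne_zero hz
  have hall := (hmer.exists_meromorphicOrderAt_ne_top_iff_forall isConnected_univ).1
    ⟨⟨_, Set.mem_univ _⟩, h0⟩
  exact (meromorphicOrderAt_ne_top_iff_eventually_ne_zero (hmer _ (Set.mem_univ _))).1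
    (hall ⟨z₀, Set.mem_univ _⟩)

/-- Taking preimages under `f` does not increase the dimension; critical points do not matter as
they are isolated. -/
lemma dimH_preimage_le (A : Set ℂ) : dimH {z | ¬ IsPole P.f z ∧ P.f z ∈ A} ≤ dimH A := by
  by_contra! h
  obtain ⟨x, hx, hlt⟩ := exists_mem_nhdsWithin_lt_dimH_of_lt_dimH h
  have hev := eventually_nhdsWithin_iff.1 (P.eventually_deriv_ne_zero x)
  refine absurd (hlt _ (inter_mem_nhdsWithin _ hev)) (not_lt.2 ?_)
  set R : Set ℂ := {z | AnalyticAt ℂ P.f z ∧ deriv P.f z ≠ 0}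
  calc dimH _ ≤ dimH ({x} ∪ R ∩ P.f ⁻¹' A) := by
        refine dimH_mono ?_
        rintro z ⟨⟨hz, hzA⟩, hzd⟩
        by_cases hzx : z = x
        · exact Or.inl hzx
        · exact Or.inr ⟨⟨P.analyticAt_f (P.not_isPole_iff.1 hz), hzd hzx⟩, hzA⟩
    _ ≤ dimH A := by
        rw [dimH_union, dimH_singleton]
        exact max_le zero_le (dimH_inter_preimage_le fun z hz => hz)

lemma dimH_iterate_preimage_le (A : Set ℂ) (m : ℕ) :
    dimH {z | (∀ n, ¬ IsPole P.f (P.f^[n] z)) ∧ P.f^[m] z ∈ A} ≤ dimH A := by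
  induction m with
  | zero => exact dimH_mono fun z hz => hz.2
  | succ m ih =>
    refine le_trans (dimH_mono ?_) ((P.dimH_preimage_le _).trans ih)
    rintro z ⟨hz, hzA⟩
    exact ⟨hz 0, fun n => hz (n + 1), hzA⟩

/-- The part of the `n`-th disc where `‖f‖ > 3`. -/
def tract (n : ℕ) : Set ℂ := {z | ‖z - P.a n‖ < P.ρ n ∧ 3 < ‖P.f z‖}

/-- The points whose orbits stay in the tracts of index at least `K`. -/
def stayingSet (K : ℕ) : Set ℂ := {z | ∀ m, ∃ n, P.f^[m] z ∈ P.tract (n + K)}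

lemma escapingSet_subset (K : ℕ) : escapingSet P.f ⊆
    ⋃ m, {z | (∀ n, ¬ IsPole P.f (P.f^[n] z)) ∧ P.f^[m] z ∈ P.stayingSet K} := by
  rintro z ⟨hz, hlim⟩
  have hnorm : Tendsto (fun n => ‖P.f^[n] z‖) atTop atTop := tendsto_norm_cocompact_atTop.comp hlim
  have h1 : ∀ᶠ m in atTop, ∀ n < K, P.a n + 1 < ‖P.f^[m] z‖ :=
    (Set.finite_lt_nat K).eventually_all.2 fun n _ => hnorm.eventually_gt_atTop _
  obtain ⟨M, hM⟩ := eventually_atTop.1 (h1.and (hnorm.eventually_gt_atTop 3))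
  refine Set.mem_iUnion.2 ⟨M, hz, fun m => ?_⟩
  rw [← Function.iterate_add_apply]
  have h2 : 3 < ‖P.f (P.f^[m + M] z)‖ := by
    rw [← Function.iterate_succ_apply' P.f]
    exact (hM _ (by omega)).2
  obtain ⟨n, hn⟩ := P.exists_mem_disc h2
  have hKn : K ≤ n := by
    by_contra! hlt
    have h3 := (hM (m + M) (by omega)).1 n hlt
    have h4 := norm_sub_norm_le (P.f^[m + M] z) (P.a n)
    rw [Complex.norm_real, Real.norm_of_nonneg (P.a_pos n).le] at h4
    linarith [P.ρ_le_one n]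
  exact ⟨n - K, by rw [Nat.sub_add_cancel hKn]; exact ⟨hn, h2⟩⟩

open ENNReal in
lemma tsum_rpow_c_ne_top {t : ℝ} (ht : 0 < t) : ∑' n, ENNReal.ofReal (P.c n) ^ t ≠ ⊤ := by
  have hq : (2⁻¹ : ℝ≥0∞) ^ t < 1 := ENNReal.rpow_lt_one (by simp) ht
  refine ne_top_of_le_ne_top (b := ∑' n, ((2⁻¹ : ℝ≥0∞) ^ t) ^ n) ?_ ?_
  · rw [ENNReal.tsum_geometric]
    exact ENNReal.inv_ne_top.2 (tsub_pos_of_lt hq).ne'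
  · refine ENNReal.tsum_le_tsum fun n => ?_
    have h1 : ENNReal.ofReal (P.c n) ≤ 2⁻¹ ^ n := by
      have h2 : P.c n ≤ (2⁻¹ : ℝ) ^ n := by
        refine (P.c_le_half_pow n).trans ?_
        rw [inv_pow, ← one_div]
        gcongr
        norm_num
      refine (ENNReal.ofReal_le_ofReal h2).trans_eq ?_
      rw [ENNReal.ofReal_pow (by norm_num), ENNReal.ofReal_inv_of_pos (by norm_num)]
      norm_num
    refine (ENNReal.rpow_le_rpow h1 ht.le).trans_eq ?_
    rw [← ENNReal.rpow_natCast, ← ENNReal.rpow_natCast, ← ENNReal.rpow_mul, ← ENNReal.rpow_mul,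
      mul_comm]

open MeasureTheory MeasureTheory.Measure ENNReal NNReal in
lemma exists_dimH_stayingSet_le {t : ℝ≥0} (ht : 0 < t) : ∃ K, dimH (P.stayingSet K) ≤ t := by
  have hlim := ENNReal.tendsto_sum_nat_add _ (P.tsum_rpow_c_ne_top (t := t) ht)
  obtain ⟨K, hK⟩ := (hlim.eventually (ge_mem_nhds (show (0 : ℝ≥0∞) < 2⁻¹ by simp))).exists
  refine ⟨K, dimH_le_of_hausdorffMeasure_ne_top ?_⟩
  have h0 : μH[(t : ℝ)] (P.stayingSet K) = 0 := by
    refine hausdorffMeasure_eq_zero_of_expanding (f := P.f) (Y := fun n => P.tract (n + K))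
      (c := fun n => ENNReal.ofReal (P.c (n + K))) t.2 (fun z hz => Set.mem_iUnion.2 (hz 0))
      (fun z hz m => hz (m + 1)) (fun n z hz w hw => ?_) (fun n => ?_) (fun n => ?_) hK
    · rw [edist_dist, edist_dist, ← ENNReal.ofReal_mul (P.c_pos _).le, dist_eq_norm, dist_eq_norm]
      exact ENNReal.ofReal_le_ofReal (P.norm_sub_le_mul hz.1 hw.1 hz.2 hw.2)
    · refine Metric.ediam_le fun z hz w hw => ?_
      rw [edist_dist]
      refine ENNReal.ofReal_le_ofReal ((dist_triangle_right z w (P.a (n + K))).trans ?_)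
      rw [dist_eq_norm, dist_eq_norm]
      linarith [P.norm_sub_pole_le hz.1 hz.2, P.norm_sub_pole_le hw.1 hw.2]
    · refine (ENNReal.ofReal_le_ofReal (P.c_le_half _)).trans_eq ?_
      rw [one_div, ENNReal.ofReal_inv_of_pos (by norm_num)]
      norm_num
  simp [h0]

lemma dimH_escapingSet : dimH (escapingSet P.f) = 0 := by
  refine le_antisymm (ENNReal.le_of_forall_pos_le_add fun t ht _ => ?_) zero_le
  rw [zero_add]
  obtain ⟨K, hK⟩ := P.exists_dimH_stayingSet_le ht
  refine (dimH_mono (P.escapingSet_subset K)).trans ?_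
  rw [dimH_iUnion]
  exact iSup_le fun m => (P.dimH_iterate_preimage_le _ m).trans hK

/-! ### Nevanlinna characteristic -/

open ValueDistribution Real MeromorphicOn

/-- The pole divisor of `f` is the sum of the points `a n`. -/
lemma negPart_divisor_apply (z : ℂ) [Decidable (∃ n, z = P.a n)] :
    (divisor P.f Set.univ)⁻ z = if ∃ n, z = P.a n then 1 else 0 := by
  have hmer : MeromorphicOn P.f Set.univ := fun z _ => P.meromorphicAt_f z
  rw [Function.locallyFinsuppWithin.negPart_apply, divisor_apply hmer (Set.mem_univ z)]
  split_ifs with hz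
  · obtain ⟨n, rfl⟩ := hz
    rw [P.order_pole n]
    rfl
  · have h : 0 ≤ meromorphicOrderAt P.f z := not_lt.1 (mt P.isPole_iff.1 hz)
    rw [negPart_eq_zero]
    exact WithTop.untop₀_nonneg.2 h

lemma norm_a (n : ℕ) : ‖(P.a n : ℂ)‖ = P.a n := by
  rw [Complex.norm_real, Real.norm_of_nonneg (P.a_pos n).le]

lemma coe_a_injective : Function.Injective fun n => (P.a n : ℂ) :=
  Complex.ofReal_injective.comp P.a_injective

lemma half_card_le_characteristic {r : ℝ} (hr : 1 ≤ r) {M : ℕ} (hM : ∀ n < M, P.a n ≤ r / 2) :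
    (M : ℝ) / 2 ≤ characteristic P.f ⊤ r := by
  classical
  have hle : ∑ n ∈ Finset.range M, Function.locallyFinsuppWithin.single (P.a n : ℂ) (1 : ℤ)
      ≤ (divisor P.f Set.univ)⁻ := by
    intro z
    rw [P.negPart_divisor_apply z, Function.locallyFinsuppWithin.coe_sum, Finset.sum_apply]
    simp only [Function.locallyFinsuppWithin.single_apply]
    split_ifs with hz
    · obtain ⟨n, rfl⟩ := hz
      have : ∀ m, ((P.a n : ℂ) = P.a m) = (n = m) := fun m => propext P.coe_a_injective.eq_iff
      simp only [this, Finset.sum_ite_eq]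
      split_ifs <;> norm_num
    · refine (Finset.sum_eq_zero fun n _ => if_neg fun h => hz ⟨n, h⟩).le
  have h1 := Function.locallyFinsuppWithin.logCounting_le hle hr
  rw [map_sum, Finset.sum_apply] at h1
  have h2 : ∀ n ∈ Finset.range M, (1 / 2 : ℝ) ≤ Function.locallyFinsuppWithin.logCounting
      (Function.locallyFinsuppWithin.single (P.a n : ℂ) (1 : ℤ)) r := by
    intro n hn
    have ha := hM n (Finset.mem_range.1 hn)
    have ha0 := P.a_pos n
    rw [Function.locallyFinsuppWithin.logCounting_single_eq_log_sub_const
      (by rw [norm_a]; linarith), norm_a, Int.cast_one, one_mul, ← Real.log_div (by linarith) ha0.ne']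
    have h3 : 2 ≤ r / P.a n := by rw [le_div_iff₀ ha0]; linarith
    have h4 := Real.log_le_log two_pos h3
    linarith [Real.log_two_gt_d9]
  have h3 := Finset.card_nsmul_le_sum _ _ _ h2
  rw [Finset.card_range, nsmul_eq_mul] at h3
  have h4 : 0 ≤ proximity P.f ⊤ r := proximity_nonneg r
  rw [characteristic, Pi.add_apply, logCounting_top]
  linarith

lemma logCounting_le {r : ℝ} (hr : 1 ≤ r) (ha : ∀ n, 1 ≤ P.a n) {M : ℕ}
    (hM : ∀ n, P.a n ≤ r → n < M) : logCounting P.f ⊤ r ≤ M * log r := by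
  classical
  rw [logCounting_top]
  simp only [Function.locallyFinsuppWithin.logCounting, AddMonoidHom.coe_mk, ZeroHom.coe_mk]
  have h0 : (divisor P.f Set.univ)⁻ 0 = 0 := by
    rw [P.negPart_divisor_apply, if_neg]
    rintro ⟨n, hn⟩
    have := P.a_pos n
    norm_cast at hn
    linarith
  have hball : ∀ z : ℂ, (Function.locallyFinsuppWithin.toClosedBall r
      (divisor P.f Set.univ)⁻) z ≠ 0 → ∃ n < M, z = P.a n := by
    intro z hz
    have hz' := Function.locallyFinsuppWithin.toClosedBall_support_subset_closedBall _ hz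
    rw [Function.locallyFinsuppWithin.toClosedBall_eval_within _ hz',
      P.negPart_divisor_apply] at hz
    split_ifs at hz with h
    · obtain ⟨n, rfl⟩ := h
      rw [mem_closedBall_zero_iff, norm_a, abs_of_pos (by linarith)] at hz'
      exact ⟨n, hM n hz', rfl⟩
    · exact absurd rfl hz
  rw [h0, Int.cast_zero, zero_mul, add_zero, finsum_eq_sum_of_support_subset
    (s := (Finset.range M).image fun n => (P.a n : ℂ)),
    Finset.sum_image (P.coe_a_injective.injOn)]
  · have hterm : ∀ n ∈ Finset.range M, ((Function.locallyFinsuppWithin.toClosedBall r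
        (divisor P.f Set.univ)⁻) (P.a n : ℂ) : ℝ) * log (r * ‖(P.a n : ℂ)‖⁻¹) ≤ log r := by
      intro n _
      by_cases hn : (P.a n : ℂ) ∈ Metric.closedBall (0 : ℂ) |r|
      · rw [Function.locallyFinsuppWithin.toClosedBall_eval_within _ hn,
          P.negPart_divisor_apply, if_pos ⟨n, rfl⟩, Int.cast_one, one_mul, norm_a]
        refine Real.log_le_log (mul_pos (by linarith) (inv_pos.2 (P.a_pos n))) ?_
        exact mul_le_of_le_one_right (by linarith) (inv_le_one_of_one_le₀ (ha n))
      · rw [Function.locallyFinsuppWithin.apply_eq_zero_of_notMem _ hn, Int.cast_zero, zero_mul]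
        exact Real.log_nonneg hr
    refine (Finset.sum_le_card_nsmul _ _ _ hterm).trans_eq ?_
    rw [Finset.card_range, nsmul_eq_mul]
  · intro z hz
    have hne : (Function.locallyFinsuppWithin.toClosedBall r
        (divisor P.f Set.univ)⁻) z ≠ 0 := by
      intro h
      simp [h] at hz
    obtain ⟨n, hn, rfl⟩ := hball z hne
    simpa using ⟨n, hn, rfl⟩

/-- If the circle of radius `r` meets at most the `n`-th disc, then `f` is bounded there up to the
`n`-th singular part, and the mean of `log ‖z - a n‖` is nonnegative by Jensen's formula. -/
lemma proximity_le {r : ℝ} (hr : 1 ≤ r) {n : ℕ}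
    (hn : ∀ m ≠ n, P.ρ m ≤ |r - P.a m|) : proximity P.f ⊤ r ≤ log 2 + log (r + P.a n) := by
  have hr0 : |r| = r := abs_of_pos (by linarith)
  have hint : CircleIntegrable (fun z => log ‖z - P.a n‖) 0 r := circleIntegrable_log_norm_sub_const r
  have hbound : ∀ z ∈ Metric.sphere (0 : ℂ) |r|,
      log⁺ ‖P.f z‖ ≤ (log 2 + log (r + P.a n)) - log ‖z - P.a n‖ := by
    intro z hz
    rw [mem_sphere_zero_iff_norm, hr0] at hz
    have hx : log⁺ ‖z - P.a n‖ ≤ log (r + P.a n) := by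
      have h1 : ‖z - P.a n‖ ≤ r + P.a n := (norm_sub_le _ _).trans_eq (by rw [hz, norm_a])
      refine (posLog_le_posLog (norm_nonneg _) h1).trans_eq (posLog_eq_log ?_)
      rw [abs_of_pos] <;> linarith [P.a_pos n]
    have hinv := posLog_sub_posLog_inv (x := ‖z - P.a n‖)
    have hinv0 := posLog_nonneg (x := ‖z - P.a n‖⁻¹)
    have hlog2 := Real.log_pos one_lt_two
    by_cases hp : ∃ m, z = P.a m
    · obtain ⟨m, rfl⟩ := hp
      rw [f_apply_pole, norm_zero, posLog_zero]
      linarith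
    · push Not at hp
      have hrest : ‖P.partialFraction {n}ᶜ z‖ ≤ 1 := by
        refine P.norm_partialFraction_le fun m hm => (hn m hm).trans ?_
        have := abs_norm_sub_norm_le z (P.a m)
        rwa [hz, norm_a] at this
      have hf : ‖P.f z‖ ≤ ‖z - P.a n‖⁻¹ + 1 := by
        rw [P.f_eq_add hp n]
        refine (norm_add_le _ _).trans (add_le_add ?_ hrest)
        rw [norm_div, Complex.norm_real, Real.norm_of_nonneg (P.c_pos n).le, div_eq_mul_inv]
        exact mul_le_of_le_one_left (by positivity) ((P.c_le_half n).trans (by norm_num))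
      have h2 := (posLog_le_posLog (norm_nonneg _) hf).trans posLog_add
      rw [posLog_one] at h2
      linarith
  have hmer : MeromorphicOn P.f (Metric.sphere 0 |r|) := fun z _ => P.meromorphicAt_f z
  rw [proximity_top]
  refine (circleAverage_mono hmer.circleIntegrable_posLog_norm
    ((circleIntegrable_const _ _ _).sub hint) hbound).trans ?_
  have hsub := circleAverage_sub (circleIntegrable_const (log 2 + log (r + P.a n)) 0 r) hint
  have hjensen := circleAverage_log_norm_sub_const_eq_log_radius_add_posLog (c := 0)
    (a := (P.a n : ℂ)) (show r ≠ 0 by linarith)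
  have h0 : 0 ≤ circleAverage (fun z : ℂ => log ‖z - P.a n‖) 0 r := by
    rw [hjensen]
    exact add_nonneg (Real.log_nonneg hr) posLog_nonneg
  rw [circleAverage_const] at hsub
  refine hsub.trans_le ?_
  linarith

end PoleConfiguration

open ValueDistribution

/-! ### The two examples -/

/-- Poles at the positive integers. -/
noncomputable def integerPoles : PoleConfiguration where
  a n := n + 1
  ρ _ := 1 / 2
  a_pos n := by positivity
  tendsto_a := tendsto_atTop_add_const_right _ _ tendsto_natCast_atTop_atTop
  ρ_pos _ := by norm_num
  ρ_le_one _ := by norm_num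
  separated m n hmn := by
    have h : (1 : ℤ) ≤ |(m : ℤ) - n| := Int.one_le_abs (sub_ne_zero.2 (by exact_mod_cast hmn))
    have h' : (1 : ℝ) ≤ |(m : ℝ) - n| := by exact_mod_cast h
    rw [add_sub_add_right_eq_sub]
    linarith

/-- Poles at the logarithms of the integers `n ≥ 2`. -/
noncomputable def logPoles : PoleConfiguration where
  a n := Real.log (n + 2)
  ρ n := 1 / (2 * (n + 3))
  a_pos n := Real.log_pos (by linarith [(Nat.cast_nonneg n : (0 : ℝ) ≤ n)])
  tendsto_a := Real.tendsto_log_atTop.comp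
    (tendsto_atTop_add_const_right _ _ tendsto_natCast_atTop_atTop)
  ρ_pos n := by positivity
  ρ_le_one n := by
    rw [div_le_one (by positivity)]
    linarith [(Nat.cast_nonneg n : (0 : ℝ) ≤ n)]
  separated := by
    have key : ∀ m n : ℕ, m < n → 1 / (2 * ((m : ℝ) + 3)) + 1 / (2 * ((n : ℝ) + 3)) ≤
        Real.log (n + 2) - Real.log (m + 2) := by
      intro m n hmn
      have hmn' : (m : ℝ) + 1 ≤ n := by exact_mod_cast hmn
      have h1 : 1 / (2 * ((n : ℝ) + 3)) ≤ 1 / (2 * ((m : ℝ) + 3)) := by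
        gcongr
      have h2 : Real.log (m + 3) ≤ Real.log (n + 2) :=
        Real.log_le_log (by positivity) (by linarith)
      -- `log x ≥ 1 - 1 / x` at `x = (m + 3) / (m + 2)`
      have h3 := Real.one_sub_inv_le_log_of_pos (show (0 : ℝ) < (m + 3) / (m + 2) by positivity)
      rw [Real.log_div (by positivity) (by positivity)] at h3
      have h4 : 1 - (((m : ℝ) + 3) / (m + 2))⁻¹ =
          1 / (2 * ((m : ℝ) + 3)) + 1 / (2 * ((m : ℝ) + 3)) := by
        field_simp
        ring
      linarith
    intro m n hmn
    rcases lt_or_gt_of_ne hmn with h | h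
    · rw [abs_sub_comm]
      exact (key m n h).trans (le_abs_self _)
    · rw [add_comm]
      exact (key n m h).trans (le_abs_self _)

lemma le_characteristic_integerPoles {r : ℝ} (hr : 4 ≤ r) :
    r / 8 ≤ characteristic integerPoles.f ⊤ r := by
  have h := integerPoles.half_card_le_characteristic (r := r) (by linarith) (M := ⌊r / 2⌋₊)
    (fun n hn => by
      have : ((n + 1 : ℕ) : ℝ) ≤ r / 2 := (Nat.le_floor_iff (by linarith)).1 hn
      simpa [integerPoles] using this)
  have := Nat.lt_floor_add_one (r / 2)
  linarith

lemma characteristic_integerPoles_le {r : ℝ} (hr : 3 ≤ r) :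
    characteristic integerPoles.f ⊤ r ≤ r ^ 3 := by
  have hlog : Real.log r ≤ r := (Real.log_le_sub_one_of_pos (by linarith)).trans (by linarith)
  have hlog0 : 0 ≤ Real.log r := Real.log_nonneg (by linarith)
  have h1 := integerPoles.logCounting_le (r := r) (by linarith)
    (fun n => by simp [integerPoles]) (M := ⌊r⌋₊) (fun n hn => by
      refine (Nat.le_floor_iff (by linarith)).2 ?_
      simpa [integerPoles] using hn)
  have hfl : (⌊r⌋₊ : ℝ) ≤ r := Nat.floor_le (by linarith)
  -- `n + 1` is the integer nearest to `r`
  obtain ⟨n, hn⟩ : ∃ n, ⌊r + 1 / 2⌋₊ = n + 1 :=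
    Nat.exists_eq_succ_of_ne_zero (Nat.floor_pos.2 (by linarith)).ne'
  have hn1 : ((n + 1 : ℕ) : ℝ) ≤ r + 1 / 2 := hn ▸ Nat.floor_le (by linarith)
  have hn2 : r + 1 / 2 < ((n + 1 : ℕ) : ℝ) + 1 := hn ▸ Nat.lt_floor_add_one (r + 1 / 2)
  push_cast at hn1 hn2
  have h2 := integerPoles.proximity_le (r := r) (by linarith) (n := n) (fun m hm => by
    simp only [integerPoles]
    rcases lt_or_gt_of_ne hm with h | h
    · have : (m : ℝ) + 1 ≤ n := by exact_mod_cast h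
      exact le_trans (by linarith) (le_abs_self _)
    · have : (n : ℝ) + 1 ≤ m := by exact_mod_cast h
      exact le_trans (by linarith) (neg_le_abs _))
  have ha : integerPoles.a n = n + 1 := rfl
  have h3 : Real.log (r + integerPoles.a n) ≤ 3 * r := by
    have := Real.log_le_sub_one_of_pos (add_pos (show (0 : ℝ) < r by linarith)
      (integerPoles.a_pos n))
    linarith
  have h4 : (⌊r⌋₊ : ℝ) * Real.log r ≤ r * r := by gcongr
  rw [characteristic, Pi.add_apply]
  nlinarith [Real.log_two_lt_d9, mul_nonneg (sub_nonneg.2 hr) (sub_nonneg.2 hr)]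

lemma growthOrder_integerPoles_pos : 0 < growthOrder integerPoles.f := by
  refine lt_of_lt_of_le (b := ((1 / 2 : ℝ) : EReal)) (by exact_mod_cast one_half_pos) ?_
  refine le_limsup_of_frequently_le (Eventually.frequently ?_)
  filter_upwards [eventually_ge_atTop (64 : ℝ)] with r hr
  have h1 := le_characteristic_integerPoles (r := r) (by linarith)
  have hlog : 0 < Real.log r := Real.log_pos (by linarith)
  rw [EReal.coe_le_coe_iff, le_div_iff₀ hlog, one_div_mul_eq_div, ← Real.log_sqrt (by linarith)]
  refine Real.log_le_log (Real.sqrt_pos.2 (by linarith)) (le_trans ?_ h1)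
  rw [Real.sqrt_le_left (by linarith)]
  nlinarith

lemma growthOrder_integerPoles_lt_top : growthOrder integerPoles.f < ⊤ := by
  refine lt_of_le_of_lt (b := ((3 : ℝ) : EReal)) ?_ (EReal.coe_lt_top 3)
  refine limsup_le_of_le (by isBoundedDefault) ?_
  filter_upwards [eventually_ge_atTop (4 : ℝ)] with r hr
  have h1 := le_characteristic_integerPoles hr
  have h2 := characteristic_integerPoles_le (r := r) (by linarith)
  rw [EReal.coe_le_coe_iff, div_le_iff₀ (Real.log_pos (by linarith))]
  refine (Real.log_le_log (by linarith) h2).trans_eq ?_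
  rw [Real.log_pow]
  norm_num

lemma exp_le_characteristic_logPoles {r : ℝ} (hr : 8 ≤ r) :
    Real.exp (r / 4) ≤ characteristic logPoles.f ⊤ r := by
  have h := logPoles.half_card_le_characteristic (r := r) (by linarith)
    (M := ⌊Real.exp (r / 2)⌋₊ - 1) (fun n hn => by
      have h1 : ((n + 2 : ℕ) : ℝ) ≤ Real.exp (r / 2) :=
        (Nat.le_floor_iff (Real.exp_pos _).le).1 (by omega)
      push_cast at h1
      exact (Real.log_le_iff_le_exp (by positivity)).2 h1)
  have h2 := Nat.lt_floor_add_one (Real.exp (r / 2))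
  have h3 : (⌊Real.exp (r / 2)⌋₊ : ℝ) ≤ ((⌊Real.exp (r / 2)⌋₊ - 1 : ℕ) : ℝ) + 1 := by
    exact_mod_cast (by omega : ⌊Real.exp (r / 2)⌋₊ ≤ ⌊Real.exp (r / 2)⌋₊ - 1 + 1)
  have h4 : Real.exp (r / 2) = Real.exp (r / 4) * Real.exp (r / 4) := by
    rw [← Real.exp_add]; ring_nf
  have h5 : 4 ≤ Real.exp (r / 4) := by
    have e : Real.exp 2 = Real.exp 1 * Real.exp 1 := by rw [← Real.exp_add]; norm_num
    have : Real.exp 2 ≤ Real.exp (r / 4) := Real.exp_le_exp.2 (by linarith)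
    nlinarith [Real.exp_one_gt_d9]
  nlinarith

lemma growthOrder_logPoles : growthOrder logPoles.f = ⊤ := by
  refine Tendsto.limsup_eq (EReal.tendsto_coe_nhds_top_iff.2 ?_)
  have h : Tendsto (fun r : ℝ => √r / 8) atTop atTop :=
    Real.tendsto_sqrt_atTop.atTop_div_const (by norm_num)
  refine tendsto_atTop_mono' _ ?_ h
  filter_upwards [eventually_ge_atTop (8 : ℝ)] with r hr
  have h1 : r / 4 ≤ Real.log (characteristic logPoles.f ⊤ r) := by
    have := Real.log_le_log (Real.exp_pos _) (exp_le_characteristic_logPoles hr)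
    rwa [Real.log_exp] at this
  have hs : 0 < √r := Real.sqrt_pos.2 (by linarith)
  have h2 : Real.log r ≤ 2 * √r := by
    have := Real.log_le_sub_one_of_pos hs
    rw [Real.log_sqrt (by linarith)] at this
    linarith
  rw [le_div_iff₀ (Real.log_pos (by linarith))]
  nlinarith [Real.mul_self_sqrt (show 0 ≤ r by linarith)]

end MeromorphicDynamics

theorem theorem1p4 :
    (∃ f : ℂ → ℂ, MeromorphicDynamics.ClassB f ∧
      0 < MeromorphicDynamics.growthOrder f ∧ MeromorphicDynamics.growthOrder f < ⊤ ∧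
      ¬ MeromorphicDynamics.IsAsymptoticValue f OnePoint.infty ∧
      MeromorphicDynamics.HasPolesOfBoundedMultiplicity f ∧
      dimH (MeromorphicDynamics.escapingSet f) = 0) ∧
    (∃ f : ℂ → ℂ, MeromorphicDynamics.ClassB f ∧
      MeromorphicDynamics.growthOrder f = ⊤ ∧
      ¬ MeromorphicDynamics.IsAsymptoticValue f OnePoint.infty ∧
      MeromorphicDynamics.HasPolesOfBoundedMultiplicity f ∧
      dimH (MeromorphicDynamics.escapingSet f) = 0) := by
  open MeromorphicDynamics in
  exact ⟨⟨integerPoles.f, integerPoles.classB_f, growthOrder_integerPoles_pos,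
      growthOrder_integerPoles_lt_top, integerPoles.not_isAsymptoticValue_infty,
      integerPoles.hasPolesOfBoundedMultiplicity_f, integerPoles.dimH_escapingSet⟩,
    ⟨logPoles.f, logPoles.classB_f, growthOrder_logPoles, logPoles.not_isAsymptoticValue_infty,
      logPoles.hasPolesOfBoundedMultiplicity_f, logPoles.dimH_escapingSet⟩⟩
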